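/- **Definitions.** A ball Banach function space $X$ on $\mathbb R$ is a Banach space of Lebesgue measurable functions whose norm $\|\cdot\|_X$ is defined, with values in $[0,\infty]$, for all measurable functions on $\mathbb R$ (with $X=\{f:\|f\|_X<\infty\}$), such that: $\|f\|_X=0$ implies $f=0$ a.e.; $|g|\le|f|$ a.e. implies $\|g\|_X\le\|f\|_X$; $0\le f_m\uparrow f$ a.e. implies $\|f_m\|_X\uparrow\|f\|_X$; $\mathbf 1_B\in X$ for every ball $B$; and for every ball $B$ there is a constant $C_{(B)}>0$ with $\int_B|f(x)|\,dx\le C_{(B)}\|f\|_X$ for all $f\in X$. For $s\in(0,\infty)$ put $\|f\|_{X^s}:=\|\,|f|^s\|_X^{1/s}$. The associate space $Y'$ of $Y$ is given by $\|f\|_{Y'}:=\sup\{\|fg\|_{L^1(\mathbb R)}:\|g\|_Y=1\}$. Let $\mathcal M f(x):=\sup_{B\ni x}\frac1{|B|}\int_B|f(y)|\,dy$ (supremum over all balls, i.e. bounded open intervals, $B$ containing $x$) be the Hardy--Littlewood maximal operator. For $\lambda\in(0,\infty)$ and $b\in\mathbb R$ let $$E_{\lambda,b}[f]:=\Big\{(x,y)\in\mathbb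 R\times\mathbb R:\ x\ne y,\ \frac{|f(x)-f(y)|}{|x-y|^{1+b}}>\lambda\Big\}.$$ **Theorem.** Let $p\in[1,\infty)$, $q\in[1,p]$ and $\gamma\in(-\infty,-1)$. There is a continuous, increasing function $C:[0,\infty)\to(0,\infty)$, depending only on $p$, $q$ and $\gamma$, with the following property. Let $X$ be a ball Banach function space on $\mathbb R$ such that $X^{1/p}$ is also a ball Banach function space and $\mathcal M$ is bounded on $(X^{1/p})'$, with operator norm $\|\mathcal M\|_{(X^{1/p})'\to(X^{1/p})'}$. Then, for every $f\in C^1(\mathbb R)$ such that $f'$ has compact support, $$\sup_{\lambda\in(0,\infty)}\lambda\left\|\left[\int_{\mathbb R}\mathbf 1_{E_{\lambda,\gamma/q}[f]}(\cdot,y)\,|\cdot-y|^{\gamma-1}\,dy\right]^{1/q}\right\|_X\le C\big(\|\mathcal M\|_{(X^{1/p})'\to(X^{1/p})'}\big)\,\|f'\|_X .$$ -/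

import Mathlib

open Filter Topology MeasureTheory
open scoped NNReal ENNReal

/-- Ball quasi-Banach function spaces `X` on `ℝ`, presented by their quasi-norm. Such a quasi-norm
is defined on all Lebesgue measurable functions (a function outside `X` has norm `∞`) and, by
the lattice property, depends only on the modulus of its argument. It is therefore
given as a functional `ρ` on `[0,∞]`-valued functions: `‖f‖_X = ρ |f|`, and `f ∈ X` iff `f` is
measurable with `ρ |f| < ∞`. Only the values at Lebesgue measurable functions (`AEMeasurable`)
matter. Completeness of `X` is a consequence of `mono` and `fatou`, hence it is not listed. -/
structure IsBallQuasiBanachFunctionNorm (ρ : (ℝ → ℝ≥0∞) → ℝ≥0∞) : Prop where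
  smul : ∀ (c : ℝ≥0) (f : ℝ → ℝ≥0∞), AEMeasurable f volume →
    ρ (fun x => (c : ℝ≥0∞) * f x) = c * ρ f
  quasi_triangle : ∃ K : ℝ≥0, ∀ f g : ℝ → ℝ≥0∞, AEMeasurable f volume → AEMeasurable g volume →
    ρ (fun x => f x + g x) ≤ K * (ρ f + ρ g)
  eq_zero : ∀ f : ℝ → ℝ≥0∞, AEMeasurable f volume → ρ f = 0 → ∀ᵐ x ∂volume, f x = 0
  mono : ∀ f g : ℝ → ℝ≥0∞, AEMeasurable f volume → AEMeasurable g volume →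
    (∀ᵐ x ∂volume, g x ≤ f x) → ρ g ≤ ρ f
  fatou : ∀ (F : ℕ → ℝ → ℝ≥0∞) (f : ℝ → ℝ≥0∞),
    (∀ m, AEMeasurable (F m) volume) → AEMeasurable f volume →
    (∀ᵐ x ∂volume, Monotone (fun m => F m x) ∧ Tendsto (fun m => F m x) atTop (𝓝 (f x))) →
    Tendsto (fun m => ρ (F m)) atTop (𝓝 (ρ f))
  ball_mem : ∀ (x : ℝ) (r : ℝ), 0 < r → ρ ((Metric.ball x r).indicator (fun _ => 1)) < ∞

/-- Ball Banach function spaces on `ℝ`: the triangle inequality holds with constant `1`, and every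
function in the space is integrable over each ball, with control by the norm. -/
structure IsBallBanachFunctionNorm (ρ : (ℝ → ℝ≥0∞) → ℝ≥0∞) : Prop
    extends IsBallQuasiBanachFunctionNorm ρ where
  triangle : ∀ f g : ℝ → ℝ≥0∞, AEMeasurable f volume → AEMeasurable g volume →
    ρ (fun x => f x + g x) ≤ ρ f + ρ g
  integral_ball_le : ∀ (x : ℝ) (r : ℝ), 0 < r → ∃ C : ℝ≥0, ∀ f : ℝ → ℝ≥0∞,
    AEMeasurable f volume → ρ f < ∞ → ∫⁻ y in Metric.ball x r, f y ≤ C * ρ f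

/-- The norm of the `s`-convexification `X^s`: `‖f‖_{X^s} = ‖ |f|^s ‖_X ^ (1/s)`. -/
noncomputable def convexification (s : ℝ) (ρ : (ℝ → ℝ≥0∞) → ℝ≥0∞) (f : ℝ → ℝ≥0∞) : ℝ≥0∞ :=
  ρ (fun x => f x ^ s) ^ (1 / s)

/-- The norm of the associate space (Köthe dual) `X'`:
`‖f‖_{X'} = sup {‖f g‖_{L¹} : ‖g‖_X = 1}`. -/
noncomputable def associateNorm (ρ : (ℝ → ℝ≥0∞) → ℝ≥0∞) (f : ℝ → ℝ≥0∞) : ℝ≥0∞ :=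
  ⨆ (g : ℝ → ℝ≥0∞) (_ : AEMeasurable g volume) (_ : ρ g = 1), ∫⁻ x, f x * g x

/-- The uncentred Hardy-Littlewood maximal function of `|f|`: the supremum of the averages over
all balls containing `x`. -/
noncomputable def hlMaximal (f : ℝ → ℝ≥0∞) (x : ℝ) : ℝ≥0∞ :=
  ⨆ (c : ℝ) (r : ℝ) (_ : 0 < r) (_ : x ∈ Metric.ball c r),
    (volume (Metric.ball c r))⁻¹ * ∫⁻ y in Metric.ball c r, f y

/-- `‖M f‖_Y ≤ A ‖f‖_Y` for all `f ∈ Y`, where `Y` is the space with norm `ρ`. -/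
def HLMaximalBoundedBy (ρ : (ℝ → ℝ≥0∞) → ℝ≥0∞) (A : ℝ≥0) : Prop :=
  ∀ f : ℝ → ℝ≥0∞, AEMeasurable f volume → ρ f < ∞ → ρ (hlMaximal f) ≤ A * ρ f

/-- The maximal operator is bounded on the space with norm `ρ`. -/
def HLMaximalBounded (ρ : (ℝ → ℝ≥0∞) → ℝ≥0∞) : Prop :=
  ∃ A : ℝ≥0, HLMaximalBoundedBy ρ A

/-- The operator norm of the maximal operator on the space with norm `ρ`. -/
noncomputable def hlMaximalOpNorm (ρ : (ℝ → ℝ≥0∞) → ℝ≥0∞) : ℝ≥0 :=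
  sInf {A : ℝ≥0 | HLMaximalBoundedBy ρ A}

/-- The superlevel set `E_{lam, b}[f]` of the difference quotients `|f x - f y| / |x - y|^(1+b)`. -/
def diffQuotSet (f : ℝ → ℂ) (lam b : ℝ) : Set (ℝ × ℝ) :=
  {z | z.1 ≠ z.2 ∧ lam < ‖f z.1 - f z.2‖ / |z.1 - z.2| ^ (1 + b)}

/-! Write `G = |f'|^q` and `a = -γ - 1 > 0`. Hölder's inequality gives `|f x - f y|^q ≤ |x -
y|^(q-1) ∫ G` over the interval between `x` and `y`. Replace that integral by `4 P(r, x)`, where `r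
= |x - y|` and `P(r, x)` integrates `G` against a bump of width `r` about `x` with quadratic tails.
A pair in the superlevel set then satisfies `r^a P(r, x) > lam^q / 4`, that is, `r > R x`, where `R
x` is the radius at which equality holds. Integrating `|x - y|^(γ-1)` over `|x - y| > R x` gives a
multiple of `(R x)^γ`, which by the equation for `R x` is a multiple of `lam^(-q) (R x)⁻¹ P(R x,
x)`, an average of `G` at scale `R x` (`sectionMeasure_le`).

Jensen's inequality raises this to the power `p / q`. Pairing with a weight `g` and exchanging
integrals leaves `∫ k x z * g x dx`, whose kernel has the variable width `R x`. The tails of the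
bump make `R` vary slowly (`IsLevelRadius.div_rpow_le`), so `R x` can be replaced by `R z` at the
cost of lowering the decay exponent from `2` to `2 - 2 / (a + 2)` (`bump_le_of_comparable`). This
still exceeds `1`, so the maximal function of `g` at `z` dominates.

The weighted bound passes to the norm by duality in `X^(1/p)`: the Lorentz–Luxemburg theorem,
Hölder's inequality and the bound for the maximal operator on the associate space. -/

/-! ### Fatou's property -/

namespace IsBallQuasiBanachFunctionNorm

variable {σ : (ℝ → ℝ≥0∞) → ℝ≥0∞}

theorem norm_zero (hσ : IsBallQuasiBanachFunctionNorm σ) : σ (fun _ => 0) = 0 := by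
  simpa using hσ.smul 0 (fun _ => 0) aemeasurable_const

/-- Fatou's property for sequences that converge almost everywhere. -/
theorem le_of_ae_tendsto (hσ : IsBallQuasiBanachFunctionNorm σ) {F : ℕ → ℝ → ℝ≥0∞}
    {f : ℝ → ℝ≥0∞} {K : ℝ≥0∞} (hF : ∀ n, AEMeasurable (F n) volume) (hf : AEMeasurable f volume)
    (hlim : ∀ᵐ x ∂volume, Tendsto (fun n => F n x) atTop (𝓝 (f x))) (hK : ∀ n, σ (F n) ≤ K) :
    σ f ≤ K := by
  -- The infima of the tails lie below `F n` and increase to the limit, so the monotone form of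
  -- Fatou's property applies to them.
  have hG : ∀ n, AEMeasurable (fun x => ⨅ k, F (n + k) x) volume := fun n =>
    AEMeasurable.iInf fun k => hF (n + k)
  refine le_of_tendsto (hσ.fatou (fun n x => ⨅ k, F (n + k) x) f hG hf ?_)
    (Eventually.of_forall fun n => ?_)
  · filter_upwards [hlim] with x hx
    have hmono : Monotone fun n => ⨅ k, F (n + k) x := by
      intro m n hmn
      refine le_iInf fun k => ?_
      have hk : m + (n - m + k) = n + k := by omega
      exact hk ▸ iInf_le (fun k => F (m + k) x) (n - m + k)
    refine ⟨hmono, ?_⟩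
    have h1 := hx.liminf_eq
    rw [Filter.liminf_eq_iSup_iInf_of_nat'] at h1
    have h2 := tendsto_atTop_iSup hmono
    convert h2 using 2
    rw [← h1]
    refine iSup_congr fun n => iInf_congr fun k => ?_
    rw [add_comm]
  · refine (hσ.mono _ _ (hF n) (hG n) (Eventually.of_forall fun x => ?_)).trans (hK n)
    exact (iInf_le _ 0)

end IsBallQuasiBanachFunctionNorm

/-! ### Duality by separation in `L²` -/

/-- Truncation of `H` to height `n` and to the ball of radius `n`. -/
noncomputable def ballTruncation (H : ℝ → ℝ≥0∞) (n : ℕ) : ℝ → ℝ≥0∞ :=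
  (Metric.ball (0 : ℝ) n).indicator fun x => min (H x) n

theorem ballTruncation_mono (H : ℝ → ℝ≥0∞) (x : ℝ) : Monotone fun n => ballTruncation H n x := by
  intro m n hmn
  have hmn' : (m : ℝ) ≤ n := by exact_mod_cast hmn
  have h2 : (m : ℝ≥0∞) ≤ n := by exact_mod_cast hmn
  unfold ballTruncation
  by_cases hx : x ∈ Metric.ball (0 : ℝ) m
  · have hx' : x ∈ Metric.ball (0 : ℝ) n := Metric.ball_subset_ball hmn' hx
    simp only [Set.indicator_of_mem hx, Set.indicator_of_mem hx']
    exact min_le_min le_rfl h2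
  · simp only [Set.indicator_of_notMem hx]
    exact zero_le

theorem ballTruncation_le (H : ℝ → ℝ≥0∞) (n : ℕ) (x : ℝ) : ballTruncation H n x ≤ H x := by
  unfold ballTruncation
  by_cases hx : x ∈ Metric.ball (0 : ℝ) n
  · simp [Set.indicator_of_mem hx]
  · simp [Set.indicator_of_notMem hx]

theorem ballTruncation_le_indicator (H : ℝ → ℝ≥0∞) (n : ℕ) (x : ℝ) :
    ballTruncation H n x ≤ (Metric.ball (0 : ℝ) n).indicator (fun _ => (n : ℝ≥0∞)) x :=
  Set.indicator_le_indicator (min_le_right _ _)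

theorem ballTruncation_ne_top (H : ℝ → ℝ≥0∞) (n : ℕ) (x : ℝ) : ballTruncation H n x ≠ ∞ := by
  refine ne_top_of_le_ne_top ?_ (ballTruncation_le_indicator H n x)
  by_cases hx : x ∈ Metric.ball (0 : ℝ) n <;> simp [hx]

theorem tendsto_ballTruncation (H : ℝ → ℝ≥0∞) (x : ℝ) :
    Tendsto (fun n => ballTruncation H n x) atTop (𝓝 (H x)) := by
  have h1 : Tendsto (fun n : ℕ => min (H x) n) atTop (𝓝 (min (H x) ∞)) :=
    tendsto_const_nhds.min ENNReal.tendsto_nat_nhds_top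
  rw [min_eq_left le_top] at h1
  refine h1.congr' ?_
  obtain ⟨N, hN⟩ := exists_nat_gt |x|
  filter_upwards [eventually_ge_atTop N] with n hn
  have : x ∈ Metric.ball (0 : ℝ) n := by
    rw [mem_ball_zero_iff, Real.norm_eq_abs]
    exact hN.trans_le (by exact_mod_cast hn)
  simp [ballTruncation, this]

theorem AEMeasurable.ballTruncation {H : ℝ → ℝ≥0∞} (hH : AEMeasurable H volume) (n : ℕ) :
    AEMeasurable (ballTruncation H n) volume :=
  (hH.min aemeasurable_const).indicator measurableSet_ball

theorem memLp_of_enorm_le_ballTruncation {H : ℝ → ℝ≥0∞} {n : ℕ} {u : ℝ → ℝ}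
    (hu : AEStronglyMeasurable u volume) (h : ∀ x, ‖u x‖ₑ ≤ ballTruncation H n x) :
    MemLp u 2 volume := by
  have h1 : MemLp ((Metric.ball (0 : ℝ) n).indicator fun _ => (n : ℝ)) 2 volume :=
    memLp_indicator_const 2 measurableSet_ball _ (Or.inr measure_ball_lt_top.ne)
  refine h1.mono hu (Eventually.of_forall fun x => ?_)
  have h2 := (h x).trans (ballTruncation_le_indicator H n x)
  rw [← enorm_le_iff_norm_le]
  refine h2.trans ?_
  by_cases hx : x ∈ Metric.ball (0 : ℝ) n
  · simp [hx]
  · simp [hx]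

/-- An `L²` limit is an almost everywhere limit along a subsequence, where Fatou's property applies.
Closedness and convexity are what Hahn–Banach separation requires. -/
theorem isClosed_setOf_norm_le {σ : (ℝ → ℝ≥0∞) → ℝ≥0∞} (hσ : IsBallQuasiBanachFunctionNorm σ)
    (K : ℝ≥0∞) : IsClosed {u : Lp ℝ 2 (volume : Measure ℝ) | σ (fun x => ‖u x‖ₑ) ≤ K} := by
  refine IsSeqClosed.isClosed fun u v hu huv => ?_
  obtain ⟨ns, -, hns⟩ := (tendstoInMeasure_of_tendsto_Lp huv).exists_seq_tendsto_ae
  refine hσ.le_of_ae_tendsto (F := fun n x => ‖u (ns n) x‖ₑ)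
    (fun n => (Lp.aestronglyMeasurable _).enorm) (Lp.aestronglyMeasurable _).enorm ?_
    fun n => hu (ns n)
  filter_upwards [hns] with x hx
  exact (continuous_enorm.tendsto _).comp hx

theorem convex_setOf_norm_le {σ : (ℝ → ℝ≥0∞) → ℝ≥0∞} (hσ : IsBallBanachFunctionNorm σ)
    (K : ℝ≥0∞) : Convex ℝ {u : Lp ℝ 2 (volume : Measure ℝ) | σ (fun x => ‖u x‖ₑ) ≤ K} := by
  intro u hu v hv a b ha hb hab
  have hum : AEMeasurable (fun x => ‖u x‖ₑ) volume := (Lp.aestronglyMeasurable u).enorm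
  have hvm : AEMeasurable (fun x => ‖v x‖ₑ) volume := (Lp.aestronglyMeasurable v).enorm
  lift a to ℝ≥0 using ha
  lift b to ℝ≥0 using hb
  have hab' : (a : ℝ≥0∞) + b = 1 := by exact_mod_cast hab
  calc σ (fun x => ‖((a : ℝ) • u + (b : ℝ) • v : Lp ℝ 2 volume) x‖ₑ)
      ≤ σ (fun x => (a : ℝ≥0∞) * ‖u x‖ₑ + (b : ℝ≥0∞) * ‖v x‖ₑ) := by
        refine hσ.mono _ _ ((hum.const_mul _).add (hvm.const_mul _))
          (Lp.aestronglyMeasurable _).enorm ?_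
        filter_upwards [Lp.coeFn_add ((a : ℝ) • u) ((b : ℝ) • v), Lp.coeFn_smul (a : ℝ) u,
          Lp.coeFn_smul (b : ℝ) v] with x h1 h2 h3
        rw [h1, Pi.add_apply, h2, h3]
        refine (enorm_add_le _ _).trans (le_of_eq ?_)
        simp [enorm_eq_nnnorm]
    _ ≤ a * σ (fun x => ‖u x‖ₑ) + b * σ (fun x => ‖v x‖ₑ) := by
        rw [← hσ.smul a _ hum, ← hσ.smul b _ hvm]
        exact hσ.triangle _ _ (hum.const_mul _) (hvm.const_mul _)
    _ ≤ a * K + b * K := by gcongr <;> assumption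
    _ = K := by rw [← add_mul, hab', one_mul]

/-- A bounded function of bounded support whose norm exceeds `K` is separated by a function from the
functions of norm at most `K`. -/
theorem exists_separating_function {σ : (ℝ → ℝ≥0∞) → ℝ≥0∞} (hσ : IsBallBanachFunctionNorm σ)
    {H : ℝ → ℝ≥0∞} (hH : AEMeasurable H volume) {n : ℕ} {K : ℝ≥0∞}
    (hK : K < σ (ballTruncation H n)) :
    ∃ g : ℝ → ℝ≥0∞, Measurable g ∧ ∃ s : ℝ≥0, 0 < s ∧ s < ∫⁻ x, H x * g x ∧
      ∀ w : ℝ → ℝ≥0∞, AEMeasurable w volume → σ w ≤ K → ∫⁻ x, w x * g x ≤ s := by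
  have hHn := hH.ballTruncation n
  have hmem : MemLp (fun x => (ballTruncation H n x).toReal) 2 volume :=
    memLp_of_enorm_le_ballTruncation hHn.ennreal_toReal.aestronglyMeasurable fun x => by
      rw [Real.enorm_eq_ofReal ENNReal.toReal_nonneg,
        ENNReal.ofReal_toReal (ballTruncation_ne_top _ _ _)]
  have hnot : hmem.toLp ∉ {u : Lp ℝ 2 (volume : Measure ℝ) | σ (fun x => ‖u x‖ₑ) ≤ K} := by
    refine fun h => hK.not_ge (le_trans ?_ h)
    refine hσ.mono _ _ (Lp.aestronglyMeasurable _).enorm hHn ?_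
    filter_upwards [hmem.coeFn_toLp] with x hx
    rw [hx, Real.enorm_eq_ofReal ENNReal.toReal_nonneg,
        ENNReal.ofReal_toReal (ballTruncation_ne_top _ _ _)]
  obtain ⟨φ, s, hφs, hsφ⟩ := geometric_hahn_banach_closed_point (convex_setOf_norm_le hσ K)
    (isClosed_setOf_norm_le hσ.toIsBallQuasiBanachFunctionNorm K) hnot
  set v : Lp ℝ 2 (volume : Measure ℝ) := (InnerProductSpace.toDual ℝ _).symm φ with hv
  have hφ : ∀ u, φ u = ∫ x, u x * v x := by
    intro u
    rw [← InnerProductSpace.toDual_symm_apply, ← hv, L2.inner_def]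
    simp
  -- The zero function lies in the convex set, so `0 = φ 0 < s`.
  have hs : 0 < s := by
    have := hφs 0 (by
      show σ _ ≤ K
      refine le_trans (le_of_eq ?_) (zero_le)
      refine le_antisymm ?_ zero_le
      rw [← hσ.norm_zero]
      refine hσ.mono _ _ aemeasurable_const (Lp.aestronglyMeasurable _).enorm ?_
      filter_upwards [Lp.coeFn_zero ℝ 2 (volume : Measure ℝ)] with x hx
      rw [hx]; simp)
    simpa using this
  -- Replacing `v` by its modulus can only increase the pairing with `H`; the bound `s` survives
  -- because the convex set is invariant under changes of sign.
  refine ⟨fun x => ‖v x‖ₑ, (Lp.stronglyMeasurable v).enorm, s.toNNReal, Real.toNNReal_pos.2 hs,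
    ?_, ?_⟩
  · calc ENNReal.ofReal s < ENNReal.ofReal (φ hmem.toLp) := (ENNReal.ofReal_lt_ofReal_iff (hs.trans hsφ)).2 hsφ
      _ ≤ ‖φ hmem.toLp‖ₑ := by
          rw [← ofReal_norm]
          exact ENNReal.ofReal_le_ofReal (le_abs_self _)
      _ ≤ ∫⁻ x, ‖(hmem.toLp : Lp ℝ 2 (volume : Measure ℝ)) x * v x‖ₑ := by
          rw [hφ]
          exact enorm_integral_le_lintegral_enorm _
      _ ≤ ∫⁻ x, H x * ‖v x‖ₑ := by
          refine lintegral_mono_ae ?_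
          filter_upwards [hmem.coeFn_toLp] with x hx
          rw [hx, enorm_mul]
          gcongr
          rw [Real.enorm_eq_ofReal ENNReal.toReal_nonneg,
            ENNReal.ofReal_toReal (ballTruncation_ne_top _ _ _)]
          exact ballTruncation_le _ _ _
  · intro w hw hwK
    have key : ∀ m, ∫⁻ x, ballTruncation w m x * ‖v x‖ₑ ≤ ENNReal.ofReal s := by
      intro m
      have hwm := hw.ballTruncation m
      -- Giving the truncation of `w` the sign of `v` keeps its modulus below `w`, hence keeps it in
      -- the convex set, and turns its pairing with `v` into the pairing with `|v|`.
      set u : ℝ → ℝ := fun x => (SignType.sign (v x) : ℝ) * (ballTruncation w m x).toReal with hu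
      have hsign : Measurable fun t : ℝ => ((SignType.sign t : SignType) : ℝ) := by
        have : (fun t : ℝ => ((SignType.sign t : SignType) : ℝ)) =
            fun t => if 0 < t then 1 else if t < 0 then -1 else 0 := by
          ext t
          rw [sign_apply]
          split_ifs <;> simp
        rw [this]
        exact Measurable.ite measurableSet_Ioi measurable_const
          (Measurable.ite measurableSet_Iio measurable_const measurable_const)
      have hum : AEStronglyMeasurable u volume :=
        ((hsign.comp (Lp.stronglyMeasurable v).measurable).aemeasurable.mul
          hwm.ennreal_toReal).aestronglyMeasurable
      have hule : ∀ x, ‖u x‖ₑ ≤ ballTruncation w m x := by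
        intro x
        rw [hu, enorm_mul, Real.enorm_eq_ofReal ENNReal.toReal_nonneg,
            ENNReal.ofReal_toReal (ballTruncation_ne_top _ _ _)]
        refine mul_le_of_le_one_left zero_le ?_
        rcases lt_trichotomy (v x) 0 with h | h | h <;> simp [h]
      have humem := memLp_of_enorm_le_ballTruncation hum hule
      set U : Lp ℝ 2 (volume : Measure ℝ) := humem.toLp with hU
      have hUu : U =ᵐ[volume] u := humem.coeFn_toLp
      have huS : U ∈ {u : Lp ℝ 2 (volume : Measure ℝ) | σ (fun x => ‖u x‖ₑ) ≤ K} := by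
        refine le_trans ?_ hwK
        refine hσ.mono _ _ hw (Lp.aestronglyMeasurable _).enorm ?_
        filter_upwards [hUu] with x hx
        rw [hx]
        exact (hule x).trans (ballTruncation_le _ _ _)
      have h1 := (hφs _ huS).le
      rw [hφ] at h1
      have h2 : Integrable (fun x => U x * v x) volume := by
        have := L2.integrable_inner (𝕜 := ℝ) v U
        simpa using this
      have h3 : ∀ᵐ x ∂volume, ENNReal.ofReal (U x * v x) =
          ballTruncation w m x * ‖v x‖ₑ ∧ 0 ≤ U x * v x := by
        filter_upwards [hUu] with x hx
        have h4 : U x * v x = (ballTruncation w m x).toReal * ‖v x‖ := by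
          rw [hx, hu, Real.norm_eq_abs, ← sign_mul_self (v x)]
          ring
        rw [h4]
        refine ⟨?_, by positivity⟩
        rw [ENNReal.ofReal_mul ENNReal.toReal_nonneg,
          ENNReal.ofReal_toReal (ballTruncation_ne_top _ _ _), ofReal_norm]
      rw [← lintegral_congr_ae (h3.mono fun x hx => hx.1),
        ← ofReal_integral_eq_lintegral_ofReal h2 (h3.mono fun x hx => hx.2)]
      exact ENNReal.ofReal_le_ofReal h1
    refine le_of_tendsto (lintegral_tendsto_of_tendsto_of_monotone
      (f := fun m x => ballTruncation w m x * ‖v x‖ₑ) ?_ ?_ ?_) (Eventually.of_forall key)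
    · exact fun m => (hw.ballTruncation m).mul (Lp.aestronglyMeasurable v).enorm
    · refine Eventually.of_forall fun x m m' h => ?_
      dsimp only
      gcongr
      exact ballTruncation_mono w x h
    · refine Eventually.of_forall fun x => ?_
      exact ENNReal.Tendsto.mul_const (tendsto_ballTruncation w x) (Or.inr enorm_ne_top)

/-- The norm is at most the norm of the second associate space (Lorentz–Luxemburg). -/
theorem norm_le_of_forall_associateNorm_le_one {σ : (ℝ → ℝ≥0∞) → ℝ≥0∞}
    (hσ : IsBallBanachFunctionNorm σ) {H : ℝ → ℝ≥0∞} (hH : AEMeasurable H volume) {K : ℝ≥0∞}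
    (h : ∀ g : ℝ → ℝ≥0∞, Measurable g → associateNorm σ g ≤ 1 → ∫⁻ x, H x * g x ≤ K) :
    σ H ≤ K := by
  refine le_of_forall_gt fun K' hK' => ?_
  -- An intermediate level `k` is nonzero even when `K = 0`, and leaves the strict gap needed for
  -- the contradiction.
  obtain ⟨k, hKk, hkK'⟩ := ENNReal.lt_iff_exists_nnreal_btwn.1 hK'
  have hk : (k : ℝ≥0∞) ≠ 0 := (zero_le.trans_lt hKk).ne'
  refine lt_of_le_of_lt ?_ hkK'
  refine hσ.le_of_ae_tendsto hH.ballTruncation hH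
    (Eventually.of_forall (tendsto_ballTruncation H)) fun n => ?_
  by_contra! hn
  obtain ⟨g, hg, s, hs, hsH, hgw⟩ := exists_separating_function hσ hH hn
  have hs' : (s : ℝ≥0∞) ≠ 0 := by exact_mod_cast hs.ne'
  -- Functions of norm `k` pair with `g` to at most `s`, so `(k / s) * g` has associate norm at most
  -- `1`, while its pairing with `H` is at least `k > K`.
  have h1 := h (fun x => (k / s : ℝ≥0∞) * g x) (hg.const_mul _) (by
    refine iSup_le fun w => iSup_le fun hw => iSup_le fun hw1 => ?_
    have h2 := hgw (fun x => (k : ℝ≥0∞) * w x) (hw.const_mul _) (by rw [hσ.smul k w hw, hw1, mul_one])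
    simp_rw [mul_assoc] at h2 ⊢
    rw [lintegral_const_mul' _ _ ENNReal.coe_ne_top] at h2
    rw [lintegral_const_mul' _ _ (ENNReal.div_lt_top ENNReal.coe_ne_top hs').ne]
    simp_rw [mul_comm (g _)]
    calc (k / s : ℝ≥0∞) * ∫⁻ x, w x * g x = (k * ∫⁻ x, w x * g x) / s := by
          rw [div_eq_mul_inv, div_eq_mul_inv]; ring
      _ ≤ s / s := by gcongr
      _ ≤ 1 := ENNReal.div_self_le_one)
  refine (h1.trans_lt hKk).not_ge ?_
  simp_rw [mul_left_comm (H _)]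
  rw [lintegral_const_mul' _ _ (ENNReal.div_lt_top ENNReal.coe_ne_top hs').ne]
  calc (k : ℝ≥0∞) = k / s * s := (ENNReal.div_mul_cancel hs' ENNReal.coe_ne_top).symm
    _ ≤ _ := by gcongr

/-- Hölder's inequality between a space and its associate space. -/
theorem lintegral_mul_le_associateNorm_mul {σ : (ℝ → ℝ≥0∞) → ℝ≥0∞}
    (hσ : IsBallQuasiBanachFunctionNorm σ) {f : ℝ → ℝ≥0∞} (hf : AEMeasurable f volume)
    (hfin : σ f ≠ ∞) (g : ℝ → ℝ≥0∞) : ∫⁻ x, f x * g x ≤ σ f * associateNorm σ g := by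
  by_cases h0 : σ f = 0
  · have : ∫⁻ x, f x * g x = 0 := by
      refine lintegral_eq_zero_of_ae_eq_zero ?_
      filter_upwards [hσ.eq_zero f hf h0] with x hx
      simp [hx]
    rw [this]
    exact zero_le
  · lift σ f to ℝ≥0 using hfin with c hc
    have hc0 : c ≠ 0 := by exact_mod_cast h0
    have h1 : σ (fun x => ((c⁻¹ : ℝ≥0) : ℝ≥0∞) * f x) = 1 := by
      rw [hσ.smul _ _ hf, ← hc]
      exact_mod_cast inv_mul_cancel₀ hc0
    have h2 : ∫⁻ x, g x * (((c⁻¹ : ℝ≥0) : ℝ≥0∞) * f x) ≤ associateNorm σ g :=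
      le_iSup_of_le _ (le_iSup_of_le (hf.const_mul _) (le_iSup_of_le h1 le_rfl))
    simp_rw [mul_left_comm (g _), mul_comm (g _)] at h2
    rw [lintegral_const_mul' _ _ ENNReal.coe_ne_top] at h2
    calc ∫⁻ x, f x * g x = c * (((c⁻¹ : ℝ≥0) : ℝ≥0∞) * ∫⁻ x, f x * g x) := by
          rw [← mul_assoc, ← ENNReal.coe_mul, mul_inv_cancel₀ hc0, ENNReal.coe_one, one_mul]
      _ ≤ _ := by gcongr

/-- The operator norm of the maximal operator is itself an admissible bound. -/
theorem hlMaximalBoundedBy_hlMaximalOpNorm {σ : (ℝ → ℝ≥0∞) → ℝ≥0∞} (h : HLMaximalBounded σ) :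
    HLMaximalBoundedBy σ (hlMaximalOpNorm σ) := by
  intro f hf hfin
  have hne : {A : ℝ≥0 | HLMaximalBoundedBy σ A}.Nonempty := h
  rw [hlMaximalOpNorm]
  -- Every number above the infimum is an admissible bound; let it decrease to the infimum.
  refine ge_of_tendsto (x := 𝓝[>] (sInf {A : ℝ≥0 | HLMaximalBoundedBy σ A}))
    (f := fun A : ℝ≥0 => (A : ℝ≥0∞) * σ f) ?_ ?_
  · refine ENNReal.Tendsto.mul_const ?_ (Or.inr hfin.ne)
    exact (ENNReal.continuous_coe.tendsto _).mono_left nhdsWithin_le_nhds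
  · filter_upwards [self_mem_nhdsWithin] with B hB
    obtain ⟨A, hA, hAB⟩ := exists_lt_of_csInf_lt hne hB
    exact (hA f hf hfin).trans (by gcongr)

/-! ### Bump integrals under change of scale and centre -/

/-- The integral of `G` against the slowly decaying bump of width `r` about `x`. -/
noncomputable def bumpIntegral (G : ℝ → ℝ≥0∞) (r x : ℝ) : ℝ≥0∞ :=
  ∫⁻ z, G z * ENNReal.ofReal ((r / (r + |x - z|)) ^ 2)

theorem bump_pos {r : ℝ} (hr : 0 < r) (x z : ℝ) : 0 < (r / (r + |x - z|)) ^ 2 := by positivity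

theorem bumpIntegral_le {G : ℝ → ℝ≥0∞} {r : ℝ} (hr : 0 < r) (x : ℝ) :
    bumpIntegral G r x ≤ ∫⁻ z, G z := by
  refine lintegral_mono fun z => mul_le_of_le_one_right zero_le ?_
  rw [ENNReal.ofReal_le_one]
  refine pow_le_one₀ (by positivity) ?_
  rw [div_le_one (by positivity)]
  linarith [abs_nonneg (x - z)]

theorem bumpIntegral_ne_zero {G : ℝ → ℝ≥0∞} (hG : Measurable G) (h0 : ∫⁻ z, G z ≠ 0) {r : ℝ}
    (hr : 0 < r) (x : ℝ) : bumpIntegral G r x ≠ 0 := by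
  contrapose! h0
  rw [bumpIntegral, lintegral_eq_zero_iff (by fun_prop)] at h0
  rw [lintegral_eq_zero_iff hG]
  filter_upwards [h0] with z hz
  have h1 := bump_pos hr x z
  rcases mul_eq_zero.1 hz with h | h
  · exact h
  · rw [ENNReal.ofReal_eq_zero] at h
    exact absurd h1 h.not_gt

theorem bumpIntegral_le_of_bump_le {G : ℝ → ℝ≥0∞} {r s x y c : ℝ} (hc : 0 ≤ c)
    (h : ∀ z, (r / (r + |x - z|)) ^ 2 ≤ c * (s / (s + |y - z|)) ^ 2) :
    bumpIntegral G r x ≤ ENNReal.ofReal c * bumpIntegral G s y := by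
  rw [bumpIntegral, bumpIntegral, ← lintegral_const_mul' _ _ ENNReal.ofReal_ne_top]
  refine lintegral_mono fun z => ?_
  rw [mul_left_comm, ← ENNReal.ofReal_mul hc]
  gcongr
  exact h z

theorem bumpIntegral_mono {G : ℝ → ℝ≥0∞} {r s : ℝ} (hs : 0 < s) (hsr : s ≤ r) (x : ℝ) :
    bumpIntegral G s x ≤ bumpIntegral G r x := by
  have hr := hs.trans_le hsr
  have := bumpIntegral_le_of_bump_le (G := G) (r := s) (s := r) (x := x) (y := x) zero_le_one
    fun z => by
      rw [one_mul]
      refine pow_le_pow_left₀ (by positivity) ?_ 2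
      rw [div_le_div_iff₀ (by positivity) (by positivity)]
      nlinarith [abs_nonneg (x - z)]
  simpa using this

theorem bumpIntegral_le_scale {G : ℝ → ℝ≥0∞} {r s : ℝ} (hs : 0 < s) (hsr : s ≤ r) (x : ℝ) :
    bumpIntegral G r x ≤ ENNReal.ofReal ((r / s) ^ 2) * bumpIntegral G s x := by
  have hr := hs.trans_le hsr
  refine bumpIntegral_le_of_bump_le (by positivity) fun z => ?_
  rw [← mul_pow]
  refine pow_le_pow_left₀ (by positivity) ?_ 2
  rw [div_mul_div_comm, mul_comm s, mul_div_mul_right _ _ hs.ne']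
  gcongr

/-- By the triangle inequality `r + |x - z| ≤ (1 + |x - y| / r) * (r + |y - z|)`. Moving the centre
thus costs only a polynomial factor, which is the reason for tails in place of a sharp cutoff. -/
theorem bumpIntegral_le_translate {G : ℝ → ℝ≥0∞} {r : ℝ} (hr : 0 < r) (x y : ℝ) :
    bumpIntegral G r y ≤ ENNReal.ofReal ((1 + |x - y| / r) ^ 2) * bumpIntegral G r x := by
  refine bumpIntegral_le_of_bump_le (by positivity) fun z => ?_
  rw [← mul_pow]
  refine pow_le_pow_left₀ (by positivity) ?_ 2
  have h1 : 1 + |x - y| / r = (r + |x - y|) / r := by field_simp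
  have h2 : |x - z| ≤ |x - y| + |y - z| := abs_sub_le x y z
  rw [h1, div_mul_div_comm, mul_comm r (r + |x - z|), mul_div_mul_right _ _ hr.ne',
    div_le_div_iff₀ (by positivity) (by positivity)]
  nlinarith [mul_nonneg (abs_nonneg (x - y)) (abs_nonneg (y - z)), abs_nonneg (x - y),
    abs_nonneg (y - z)]

theorem measurable_bumpIntegral {G : ℝ → ℝ≥0∞} (hG : Measurable G) (r : ℝ) :
    Measurable (bumpIntegral G r) := by
  refine Measurable.lintegral_prod_right' (f := fun w : ℝ × ℝ =>
    G w.2 * ENNReal.ofReal ((r / (r + |w.1 - w.2|)) ^ 2)) ?_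
  fun_prop

theorem setLIntegral_le_bumpIntegral {G : ℝ → ℝ≥0∞} {r x : ℝ} (hr : 0 < r) {s : Set ℝ}
    (hsm : MeasurableSet s) (hs : ∀ z ∈ s, |x - z| ≤ r) :
    ∫⁻ z in s, G z ≤ 4 * bumpIntegral G r x := by
  rw [bumpIntegral, ← lintegral_const_mul' _ _ (by simp)]
  refine (setLIntegral_mono' hsm fun z hz => ?_).trans (setLIntegral_le_lintegral s _)
  -- On `s` the denominator is at most `2 * r`, so the bump is at least `1 / 4`.
  have h1 : (1 : ℝ) ≤ 4 * (r / (r + |x - z|)) ^ 2 := by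
    have h2 : 1 / 2 ≤ r / (r + |x - z|) := by
      rw [div_le_div_iff₀ (by norm_num) (by positivity)]
      linarith [hs z hz]
    nlinarith
  calc G z = G z * 1 := (mul_one _).symm
    _ ≤ G z * ENNReal.ofReal (4 * (r / (r + |x - z|)) ^ 2) := by
        gcongr
        rwa [ENNReal.one_le_ofReal]
    _ = _ := by
        rw [ENNReal.ofReal_mul (by norm_num), ENNReal.ofReal_ofNat, mul_left_comm]

/-! ### The level radius -/

/-- A positive function whose growth lies between two positive powers takes all positive values. -/
theorem exists_eq_of_power_growth {Φ : ℝ → ℝ} {a b L : ℝ} (ha : 0 < a) (hL : 0 < L)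
    (hpos : ∀ r, 0 < r → 0 < Φ r)
    (hlow : ∀ s r, 0 < s → s ≤ r → (r / s) ^ a * Φ s ≤ Φ r)
    (hupp : ∀ s r, 0 < s → s ≤ r → Φ r ≤ (r / s) ^ b * Φ s) : ∃ r, 0 < r ∧ Φ r = L := by
  -- In logarithmic coordinates the growth bounds become slopes between `a` and `b`: `h` is
  -- Lipschitz and, as `a > 0`, unbounded in both directions, hence surjective.
  set h : ℝ → ℝ := fun t => Real.log (Φ (Real.exp t)) with hh
  have hp : ∀ t, 0 < Φ (Real.exp t) := fun t => hpos _ (Real.exp_pos t)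
  have hlog : ∀ (c s t : ℝ), Real.log ((Real.exp t / Real.exp s) ^ c * Φ (Real.exp s)) =
      c * (t - s) + h s := by
    intro c s t
    rw [Real.log_mul (by positivity) (hp s).ne', Real.log_rpow (by positivity), ← Real.exp_sub,
      Real.log_exp]
  have h1 : ∀ s t, s ≤ t → a * (t - s) + h s ≤ h t := by
    intro s t hst
    rw [← hlog]
    exact Real.log_le_log (mul_pos (by positivity) (hp s))
      (hlow _ _ (Real.exp_pos s) (Real.exp_le_exp.2 hst))
  have h2 : ∀ s t, s ≤ t → h t ≤ b * (t - s) + h s := by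
    intro s t hst
    rw [← hlog]
    exact Real.log_le_log (hp t) (hupp _ _ (Real.exp_pos s) (Real.exp_le_exp.2 hst))
  have hlip : LipschitzWith b.toNNReal h := by
    refine LipschitzWith.of_le_add_mul _ fun s t => ?_
    have hb : b ≤ b.toNNReal := Real.le_coe_toNNReal b
    rcases le_total t s with hst | hst
    · have := h2 t s hst
      rw [Real.dist_eq, abs_of_nonneg (sub_nonneg.2 hst)]
      nlinarith
    · have := h1 s t hst
      have h3 : 0 ≤ (b.toNNReal : ℝ) * dist s t := by positivity
      nlinarith
  have htop : Tendsto h atTop atTop := by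
    refine tendsto_atTop_mono' atTop (f₁ := fun t => a * t + h 0) ?_
      (tendsto_atTop_add_const_right _ _ (tendsto_id.const_mul_atTop ha))
    filter_upwards [eventually_ge_atTop 0] with t ht
    simpa using h1 0 t ht
  have hbot : Tendsto h atBot atBot := by
    have h3 : Tendsto (fun t => a * t + h 0) atBot atBot :=
      tendsto_atBot_add_const_right _ _ (tendsto_id.const_mul_atBot ha)
    refine tendsto_atBot_mono' atBot ?_ h3
    filter_upwards [eventually_le_atBot 0] with t ht
    have := h1 t 0 ht
    linarith
  obtain ⟨t, ht⟩ := hlip.continuous.surjective htop hbot (Real.log L)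
  exact ⟨Real.exp t, Real.exp_pos t, Real.log_injOn_pos (hp t) hL ht⟩

/-- The radius at which the scaled bump integral reaches a given level. -/
structure IsLevelRadius (G : ℝ → ℝ≥0∞) (a L : ℝ) (R : ℝ → ℝ) : Prop where
  pos : ∀ x, 0 < R x
  eq : ∀ x, R x ^ a * (bumpIntegral G (R x) x).toReal = L

section

variable {G : ℝ → ℝ≥0∞} {a L : ℝ} {R : ℝ → ℝ}

theorem bumpIntegral_toReal_pos (hG : Measurable G) (h0 : ∫⁻ z, G z ≠ 0)
    (htop : ∫⁻ z, G z ≠ ∞) {r : ℝ} (hr : 0 < r) (x : ℝ) : 0 < (bumpIntegral G r x).toReal :=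
  ENNReal.toReal_pos (bumpIntegral_ne_zero hG h0 hr x)
    (ne_top_of_le_ne_top htop (bumpIntegral_le hr x))

theorem bumpIntegral_toReal_mono (htop : ∫⁻ z, G z ≠ ∞) {r s : ℝ} (hs : 0 < s) (hsr : s ≤ r)
    (x : ℝ) : (bumpIntegral G s x).toReal ≤ (bumpIntegral G r x).toReal :=
  ENNReal.toReal_mono (ne_top_of_le_ne_top htop (bumpIntegral_le (hs.trans_le hsr) x))
    (bumpIntegral_mono hs hsr x)

theorem exists_isLevelRadius (hG : Measurable G) (h0 : ∫⁻ z, G z ≠ 0) (htop : ∫⁻ z, G z ≠ ∞)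
    (ha : 0 < a) (hL : 0 < L) : ∃ R, IsLevelRadius G a L R := by
  have hfin : ∀ {r : ℝ} (_ : 0 < r) (x : ℝ), bumpIntegral G r x ≠ ∞ := fun hr x =>
    ne_top_of_le_ne_top htop (bumpIntegral_le hr x)
  have : ∀ x, ∃ r, 0 < r ∧ r ^ a * (bumpIntegral G r x).toReal = L := by
    intro x
    -- The lower exponent `a` comes from the power of `r` alone; the bump integral adds growth of
    -- order at most `2`.
    refine exists_eq_of_power_growth (Φ := fun r => r ^ a * (bumpIntegral G r x).toReal)
      (b := a + 2) ha hL (fun r hr => ?_) (fun s r hs hsr => ?_) fun s r hs hsr => ?_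
    · exact mul_pos (by positivity) (bumpIntegral_toReal_pos hG h0 htop hr x)
    · have hr := hs.trans_le hsr
      have hsa : (0 : ℝ) < s ^ a := by positivity
      rw [Real.div_rpow hr.le hs.le, ← mul_assoc, div_mul_cancel₀ _ hsa.ne']
      exact mul_le_mul_of_nonneg_left (bumpIntegral_toReal_mono htop hs hsr x) (by positivity)
    · have hr := hs.trans_le hsr
      have hsa : (0 : ℝ) < s ^ a := by positivity
      have h1 := ENNReal.toReal_mono (ENNReal.mul_ne_top ENNReal.ofReal_ne_top (hfin hs x))
        (bumpIntegral_le_scale (G := G) hs hsr x)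
      rw [ENNReal.toReal_mul, ENNReal.toReal_ofReal (by positivity)] at h1
      have h2 : (r / s) ^ (a + 2) * (s ^ a * (bumpIntegral G s x).toReal) =
          r ^ a * ((r / s) ^ 2 * (bumpIntegral G s x).toReal) := by
        rw [Real.rpow_add (by positivity), Real.div_rpow hr.le hs.le, Real.rpow_two]
        field_simp
      rw [h2]
      gcongr
  choose R hR using this
  exact ⟨R, fun x => (hR x).1, fun x => (hR x).2⟩

/-- The function `r ^ a * P(r, x)` is strictly increasing in `r`, as `a > 0` and the positive factor
`P` is nondecreasing. -/
theorem IsLevelRadius.lt_iff (hR : IsLevelRadius G a L R) (hG : Measurable G)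
    (h0 : ∫⁻ z, G z ≠ 0) (htop : ∫⁻ z, G z ≠ ∞) (ha : 0 < a) {r : ℝ} (hr : 0 < r) (x : ℝ) :
    R x < r ↔ L < r ^ a * (bumpIntegral G r x).toReal := by
  rw [← hR.eq x]
  constructor
  · intro h
    have h1 := bumpIntegral_toReal_mono htop (hR.pos x) h.le x
    have h2 := bumpIntegral_toReal_pos hG h0 htop (hR.pos x) x
    have h3 := Real.rpow_lt_rpow (hR.pos x).le h ha
    have h4 : 0 < r ^ a := by positivity
    nlinarith
  · intro h
    by_contra! hle
    refine h.not_ge ?_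
    have := bumpIntegral_toReal_mono htop hr hle x
    have := (hR.pos x).le
    gcongr

theorem IsLevelRadius.measurable (hR : IsLevelRadius G a L R) (hG : Measurable G)
    (h0 : ∫⁻ z, G z ≠ 0) (htop : ∫⁻ z, G z ≠ ∞) (ha : 0 < a) : Measurable R := by
  refine measurable_of_Iio fun r => ?_
  rcases le_or_gt r 0 with hr | hr
  · have : R ⁻¹' Set.Iio r = ∅ := by
      ext x
      simpa using hr.trans (hR.pos x).le
    simp [this]
  · have : R ⁻¹' Set.Iio r = {x | L < r ^ a * (bumpIntegral G r x).toReal} := by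
      ext x
      exact hR.lt_iff hG h0 htop ha hr x
    rw [this]
    exact measurableSet_lt measurable_const
      ((measurable_bumpIntegral hG r).ennreal_toReal.const_mul _)

/-- Slow variation. If `R y ≤ R x`, the level equations give `(R x / R y)^a = P(R y, y) / P(R x,
x)`. Enlarging the radius at `y` to `R x` and then moving the centre to `x` bounds this by the
translation factor. -/
theorem IsLevelRadius.div_rpow_le (hR : IsLevelRadius G a L R) (hG : Measurable G)
    (h0 : ∫⁻ z, G z ≠ 0) (htop : ∫⁻ z, G z ≠ ∞) (ha : 0 < a) (x y : ℝ) :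
    (R x / R y) ^ a ≤ (1 + |x - y| / R x) ^ 2 := by
  have hx := hR.pos x
  have hy := hR.pos y
  rcases le_total (R x) (R y) with h | h
  · calc (R x / R y) ^ a ≤ 1 := Real.rpow_le_one (by positivity) ((div_le_one hy).2 h) ha.le
      _ ≤ (1 + |x - y| / R x) ^ 2 := one_le_pow₀ (by
          have : 0 ≤ |x - y| / R x := by positivity
          linarith)
  · have h1 := bumpIntegral_toReal_mono htop hy h y
    have h2 := ENNReal.toReal_mono (ENNReal.mul_ne_top ENNReal.ofReal_ne_top
      (ne_top_of_le_ne_top htop (bumpIntegral_le hx x))) (bumpIntegral_le_translate (G := G) hx x y)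
    rw [ENNReal.toReal_mul, ENNReal.toReal_ofReal (by positivity)] at h2
    have h3 := bumpIntegral_toReal_pos hG h0 htop hx x
    rw [Real.div_rpow hx.le hy.le, div_le_iff₀ (by positivity)]
    refine le_of_mul_le_mul_right ?_ h3
    rw [hR.eq x, ← hR.eq y, mul_right_comm, mul_comm]
    gcongr
    exact h1.trans h2

end

/-! ### Kernels of variable width and the maximal function -/

/-- With `u = r / s` and `t = d / s`, the hypotheses bound `u` below when `t ≤ 1` and above by a
multiple of `(1 + t)^(2/(a+2))` when `t ≥ 1`. The latter is the source of the loss in decay. -/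
theorem bump_le_of_comparable {a r s d : ℝ} (ha : 0 < a) (hr : 0 < r) (hs : 0 < s) (hd : 0 ≤ d)
    (h1 : (r / s) ^ a ≤ (1 + d / r) ^ 2) (h2 : (s / r) ^ a ≤ (1 + d / s) ^ 2) :
    r / (r + d) ^ 2 ≤ 4 * 4 ^ (1 / a) * (s⁻¹ * (1 + d / s) ^ (-(2 - 2 / (a + 2)))) := by
  obtain ⟨t, rfl⟩ : ∃ t, d = t * s := ⟨d / s, by field_simp⟩
  obtain ⟨u, rfl⟩ : ∃ u, r = u * s := ⟨r / s, by field_simp⟩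
  have hu : 0 < u := pos_of_mul_pos_left hr hs.le
  have ht : 0 ≤ t := nonneg_of_mul_nonneg_left hd hs
  rw [mul_div_mul_right _ _ hs.ne', mul_div_cancel_right₀ _ hs.ne'] at h1
  rw [mul_div_cancel_right₀ _ hs.ne', div_mul_cancel_right₀ hs.ne'] at h2
  rw [mul_div_cancel_right₀ _ hs.ne']
  have h4 : (1 : ℝ) ≤ 4 ^ (1 / a) := Real.one_le_rpow (by norm_num) (by positivity)
  have h4a : ((4 : ℝ) ^ (1 / a)) ^ a = 4 := by
    rw [← Real.rpow_mul (by norm_num), one_div_mul_cancel ha.ne', Real.rpow_one]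
  have hroot : ∀ {v : ℝ}, 0 < v → v ^ a ≤ 4 → v ≤ 4 ^ (1 / a) := by
    intro v hv h
    rw [← h4a] at h
    exact (Real.rpow_le_rpow_iff hv.le (by positivity) ha).1 h
  have h1t : (0 : ℝ) < 1 + t := by positivity
  set e : ℝ := 2 / (a + 2) with he
  have he0 : 0 < e := by positivity
  have hsplit : (1 + t) ^ (-(2 - e)) = (1 + t) ^ e / (1 + t) ^ 2 := by
    rw [neg_sub, Real.rpow_sub h1t, Real.rpow_two]
  have hge1 : 1 ≤ (1 + t) ^ e := Real.one_le_rpow (by linarith) he0.le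
  have hscale : u * s / (u * s + t * s) ^ 2 = s⁻¹ * (u / (u + t) ^ 2) := by
    have : 0 < u + t := by positivity
    field_simp
  rw [hscale, mul_left_comm, hsplit]
  refine mul_le_mul_of_nonneg_left ?_ (by positivity)
  rw [← mul_div_assoc, div_le_div_iff₀ (by positivity) (by positivity)]
  rcases le_total t 1 with htle | htge
  · have hinv : u⁻¹ ≤ 4 ^ (1 / a) := hroot (by positivity) (h2.trans (by nlinarith))
    have h5 : 1 ≤ 4 ^ (1 / a) * u := by
      rwa [inv_le_iff_one_le_mul₀ hu] at hinv
    calc u * (1 + t) ^ 2 ≤ u * 4 := by gcongr; nlinarith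
      _ ≤ 4 * (4 ^ (1 / a) * u) * u := by nlinarith
      _ = 4 * 4 ^ (1 / a) * 1 * u ^ 2 := by ring
      _ ≤ 4 * 4 ^ (1 / a) * (1 + t) ^ e * (u + t) ^ 2 := by
          gcongr
          linarith
  · have hu2 : u ≤ 4 ^ (1 / a) * (1 + t) ^ e := by
      -- If `u ≤ 1 + t`, multiplying `u^a ≤ (1 + t/u)^2` by `u^2` gives `u^(a+2) ≤ (u + t)^2`,
      -- whence the exponent `2 / (a + 2)`. Otherwise `t / u ≤ 1`, and `u` is bounded outright.
      rcases le_total u (1 + t) with hut | hut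
      · have h6 : u ^ (a + 2) ≤ 4 * (1 + t) ^ 2 := by
          rw [Real.rpow_add hu, Real.rpow_two]
          have h7 : u * (1 + t / u) = u + t := by field_simp
          calc u ^ a * u ^ 2 ≤ (1 + t / u) ^ 2 * u ^ 2 := by gcongr
            _ = (u + t) ^ 2 := by rw [← h7]; ring
            _ ≤ 4 * (1 + t) ^ 2 := by nlinarith
        have h8 : (4 ^ (1 / a) * (1 + t) ^ e) ^ (a + 2) = 4 ^ (1 / a * (a + 2)) * (1 + t) ^ 2 := by
          rw [Real.mul_rpow (by positivity) (by positivity), ← Real.rpow_mul (by norm_num),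
            ← Real.rpow_mul h1t.le, he, div_mul_cancel₀ _ (by positivity), Real.rpow_two]
        have h9 : (4 : ℝ) ≤ 4 ^ (1 / a * (a + 2)) := by
          have : 1 ≤ 1 / a * (a + 2) := by
            rw [one_div, ← div_eq_inv_mul, one_le_div ha]
            linarith
          simpa using Real.rpow_le_rpow_of_exponent_le (x := 4) (by norm_num) this
        refine (Real.rpow_le_rpow_iff hu.le (by positivity) (z := a + 2) (by positivity)).1 ?_
        rw [h8]
        exact h6.trans (by gcongr)
      · have h6 : t / u ≤ 1 := (div_le_one hu).2 (by linarith)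
        have h7 : 0 ≤ t / u := by positivity
        have h8 : u ≤ 4 ^ (1 / a) := hroot hu (h1.trans (by nlinarith))
        exact h8.trans (le_mul_of_one_le_right (by positivity) hge1)
    calc u * (1 + t) ^ 2 ≤ 4 ^ (1 / a) * (1 + t) ^ e * (1 + t) ^ 2 := by gcongr
      _ ≤ 4 ^ (1 / a) * (1 + t) ^ e * (4 * (u + t) ^ 2) := by
          gcongr
          nlinarith
      _ = 4 * 4 ^ (1 / a) * (1 + t) ^ e * (u + t) ^ 2 := by ring

theorem lintegral_mul_le_hlMaximal {g : ℝ → ℝ≥0∞} (z : ℝ) {r : ℝ} (hr : 0 < r) :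
    ∫⁻ x in Metric.ball z r, g x ≤ ENNReal.ofReal (2 * r) * hlMaximal g z := by
  have h1 : (volume (Metric.ball z r))⁻¹ * ∫⁻ x in Metric.ball z r, g x ≤ hlMaximal g z :=
    le_iSup_of_le z (le_iSup_of_le r (le_iSup_of_le hr
      (le_iSup_of_le (Metric.mem_ball_self hr) le_rfl)))
  rw [Real.volume_ball] at h1
  rwa [mul_comm, ← div_eq_mul_inv, ENNReal.div_le_iff' (by simpa using hr)
    ENNReal.ofReal_ne_top] at h1

/-- Averages against a radially decreasing integrable kernel are controlled by the maximal
function. -/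
theorem exists_lintegral_radial_le_hlMaximal {θ : ℝ} (hθ : 1 < θ) :
    ∃ C : ℝ≥0, ∀ g : ℝ → ℝ≥0∞, Measurable g → ∀ z s : ℝ, 0 < s →
      ∫⁻ x, ENNReal.ofReal (s⁻¹ * (1 + |x - z| / s) ^ (-θ)) * g x ≤ C * hlMaximal g z := by
  set ϑ : ℝ := 2 ^ (1 - θ) with hϑ
  have hϑ0 : 0 < ϑ := by positivity
  have hϑ1 : ϑ < 1 := Real.rpow_lt_one_of_one_lt_of_neg (by norm_num) (by linarith)
  have hsum : Summable fun n : ℕ => 4 * ϑ ^ n :=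
    (summable_geometric_of_lt_one hϑ0.le hϑ1).mul_left 4
  refine ⟨(∑' n : ℕ, 4 * ϑ ^ n).toNNReal, fun g hg z s hs => ?_⟩
  -- Choose `n` with `2^n ≤ 1 + |x - z| / s < 2^(n+1)`. The `n`th ball has length `4 * 2^n * s`, so
  -- its term is `4 * ϑ^n`, summable because `θ > 1`.
  have hpt : ∀ x, ENNReal.ofReal (s⁻¹ * (1 + |x - z| / s) ^ (-θ)) * g x ≤
      ∑' n : ℕ, (Metric.ball z (2 ^ (n + 1) * s)).indicator
        (fun x => ENNReal.ofReal (s⁻¹ * ((2 : ℝ) ^ n) ^ (-θ)) * g x) x := by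
    intro x
    have h0 : 0 ≤ |x - z| / s := by positivity
    obtain ⟨n, hn1, hn2⟩ := exists_nat_pow_near (x := 1 + |x - z| / s) (y := 2) (by linarith)
      (by norm_num)
    refine le_trans ?_ (ENNReal.le_tsum n)
    have hx : x ∈ Metric.ball z (2 ^ (n + 1) * s) := by
      rw [Metric.mem_ball, Real.dist_eq, ← div_lt_iff₀ hs]
      linarith
    rw [Set.indicator_of_mem hx]
    have h1 : (1 + |x - z| / s) ^ (-θ) ≤ ((2 : ℝ) ^ n) ^ (-θ) :=
      Real.rpow_le_rpow_of_nonpos (by positivity) hn1 (by linarith)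
    gcongr
  have hterm : ∀ n : ℕ, ∫⁻ x, (Metric.ball z (2 ^ (n + 1) * s)).indicator
        (fun x => ENNReal.ofReal (s⁻¹ * ((2 : ℝ) ^ n) ^ (-θ)) * g x) x ≤
      ENNReal.ofReal (4 * ϑ ^ n) * hlMaximal g z := by
    intro n
    rw [lintegral_indicator measurableSet_ball, lintegral_const_mul' _ _ ENNReal.ofReal_ne_top]
    refine (mul_le_mul_right (lintegral_mul_le_hlMaximal z (by positivity)) _).trans ?_
    rw [← mul_assoc, ← ENNReal.ofReal_mul (by positivity)]
    refine le_of_eq ?_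
    congr 2
    have h1 : ((2 : ℝ) ^ n) ^ (-θ) * 2 ^ n = ϑ ^ n := by
      rw [hϑ, ← Real.rpow_natCast, ← Real.rpow_natCast, ← Real.rpow_mul (by norm_num),
        ← Real.rpow_mul (by norm_num), ← Real.rpow_add (by norm_num)]
      congr 1
      ring
    rw [← h1]
    field_simp
    ring
  calc ∫⁻ x, ENNReal.ofReal (s⁻¹ * (1 + |x - z| / s) ^ (-θ)) * g x
      ≤ ∫⁻ x, ∑' n : ℕ, (Metric.ball z (2 ^ (n + 1) * s)).indicator
          (fun x => ENNReal.ofReal (s⁻¹ * ((2 : ℝ) ^ n) ^ (-θ)) * g x) x := lintegral_mono hpt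
    _ = ∑' n : ℕ, ∫⁻ x, (Metric.ball z (2 ^ (n + 1) * s)).indicator
          (fun x => ENNReal.ofReal (s⁻¹ * ((2 : ℝ) ^ n) ^ (-θ)) * g x) x :=
        lintegral_tsum fun n =>
          ((hg.const_mul _).indicator measurableSet_ball).aemeasurable
    _ ≤ ∑' n : ℕ, ENNReal.ofReal (4 * ϑ ^ n) * hlMaximal g z := ENNReal.tsum_le_tsum hterm
    _ = _ := by
        rw [ENNReal.tsum_mul_right, ← ENNReal.ofReal_tsum_of_nonneg (fun n => by positivity) hsum]
        rfl

/-! ### Difference and kernel estimates -/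

/-- Jensen's inequality for powers and finite measures. -/
theorem lintegral_rpow_le_measure_univ_mul {α : Type*} [MeasurableSpace α] (μ : Measure α)
    {u : α → ℝ≥0∞} (hu : AEMeasurable u μ) {r : ℝ} (hr : 1 ≤ r) :
    (∫⁻ x, u x ∂μ) ^ r ≤ μ Set.univ ^ (r - 1) * ∫⁻ x, u x ^ r ∂μ := by
  rcases hr.eq_or_lt with rfl | hr
  · simp
  have hr0 : 0 < r := by linarith
  have hconj := Real.HolderConjugate.conjExponent hr
  have h1 := ENNReal.lintegral_mul_le_Lp_mul_Lq μ hconj hu (aemeasurable_const (b := (1 : ℝ≥0∞)))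
  simp only [Pi.mul_apply, mul_one, ENNReal.one_rpow, lintegral_const, one_mul] at h1
  refine (ENNReal.rpow_le_rpow h1 hr0.le).trans (le_of_eq ?_)
  rw [ENNReal.mul_rpow_of_nonneg _ _ hr0.le, ← ENNReal.rpow_mul, ← ENNReal.rpow_mul,
    one_div_mul_cancel hr0.ne', ENNReal.rpow_one, mul_comm]
  congr 2
  rw [Real.conjExponent]
  field_simp

/-- The fundamental theorem of calculus, then Jensen's inequality on an interval of length `|x -
y|`. -/
theorem enorm_sub_rpow_le {f : ℝ → ℂ} (hf : ContDiff ℝ 1 f) {q : ℝ} (hq : 1 ≤ q) (x y : ℝ) :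
    ‖f x - f y‖ₑ ^ q ≤
      ENNReal.ofReal (|x - y| ^ (q - 1)) * ∫⁻ z in Set.uIoc y x, ‖deriv f z‖ₑ ^ q := by
  have hd : Continuous (deriv f) := hf.continuous_deriv le_rfl
  have h1 : ‖f x - f y‖ₑ ≤ ∫⁻ z in Set.uIoc y x, ‖deriv f z‖ₑ := by
    rw [← intervalIntegral.integral_deriv_eq_sub
      (fun z _ => hf.differentiable one_ne_zero z) (hd.intervalIntegrable _ _),
      ← enorm_norm, intervalIntegral.norm_intervalIntegral_eq, enorm_norm]
    exact enorm_integral_le_lintegral_enorm _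
  refine (ENNReal.rpow_le_rpow h1 (by linarith)).trans ?_
  refine (lintegral_rpow_le_measure_univ_mul _ hd.enorm.measurable.aemeasurable hq).trans
    (le_of_eq ?_)
  rw [Measure.restrict_apply_univ, Set.uIoc, Real.volume_Ioc, max_sub_min_eq_abs',
    abs_sub_comm, ENNReal.ofReal_rpow_of_nonneg (abs_nonneg _) (by linarith)]

theorem lintegral_Ici_rpow {s r : ℝ} (hs : s < -1) (hr : 0 < r) :
    ∫⁻ v in Set.Ici r, ENNReal.ofReal (v ^ s) = ENNReal.ofReal (-r ^ (s + 1) / (s + 1)) := by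
  rw [setLIntegral_congr Ioi_ae_eq_Ici.symm, ← integral_Ioi_rpow_of_lt hs hr,
    ofReal_integral_eq_lintegral_ofReal (integrableOn_Ioi_rpow_of_lt hs hr)]
  filter_upwards [ae_restrict_mem measurableSet_Ioi] with v hv
  have : 0 < v := hr.trans hv
  positivity

theorem lintegral_indicator_lt_abs_sub_rpow_le {s r : ℝ} (hs : s < -1) (hr : 0 < r) (x : ℝ) :
    ∫⁻ y, {y | r < |x - y|}.indicator (fun y => ENNReal.ofReal (|x - y| ^ s)) y ≤
      ENNReal.ofReal (2 * (-r ^ (s + 1) / (s + 1))) := by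
  set φ : ℝ → ℝ≥0∞ := (Set.Ici r).indicator fun v => ENNReal.ofReal (v ^ s) with hφ
  have hφm : Measurable φ := Measurable.indicator (by fun_prop) measurableSet_Ici
  have hφi : ∫⁻ v, φ v = ENNReal.ofReal (-r ^ (s + 1) / (s + 1)) := by
    rw [hφ, lintegral_indicator measurableSet_Ici, lintegral_Ici_rpow hs hr]
  calc ∫⁻ y, {y | r < |x - y|}.indicator (fun y => ENNReal.ofReal (|x - y| ^ s)) y
      ≤ ∫⁻ y, (φ (x - y) + φ (y - x)) := by
        refine lintegral_mono fun y => ?_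
        by_cases hy : y ∈ {y | r < |x - y|}
        swap
        · rw [Set.indicator_of_notMem hy]
          exact zero_le
        rw [Set.indicator_of_mem hy]
        have hy : r < |x - y| := hy
        rcases abs_cases (x - y) with h | h
        · refine le_add_right (le_of_eq ?_)
          rw [h.1] at hy
          rw [hφ, Set.indicator_of_mem (Set.mem_Ici.2 hy.le), h.1]
        · refine le_add_left (le_of_eq ?_)
          rw [h.1, neg_sub] at hy
          rw [hφ, Set.indicator_of_mem (Set.mem_Ici.2 hy.le), h.1, neg_sub]
    _ = _ := by
        rw [lintegral_add_left (by fun_prop), lintegral_sub_left_eq_self,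
          lintegral_sub_right_eq_self, hφi, ← two_mul, ENNReal.ofReal_mul (by norm_num),
          ENNReal.ofReal_ofNat]

/-- Substituting `v = r + |x - z|` on each side of `x` gives two copies of `∫ r * v^(-2)` over `v ≥
r`, each equal to `1`. -/
theorem lintegral_bump_le {r : ℝ} (hr : 0 < r) (x : ℝ) :
    ∫⁻ z, ENNReal.ofReal (r / (r + |x - z|) ^ 2) ≤ 2 := by
  set φ : ℝ → ℝ≥0∞ := (Set.Ici r).indicator fun v => ENNReal.ofReal (v ^ (-2 : ℝ)) with hφ
  have hφm : Measurable φ := Measurable.indicator (by fun_prop) measurableSet_Ici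
  have hφi : ∫⁻ v, φ v = ENNReal.ofReal r⁻¹ := by
    rw [hφ, lintegral_indicator measurableSet_Ici, lintegral_Ici_rpow (by norm_num) hr]
    congr 1
    norm_num [Real.rpow_neg_one]
  have hval : ∀ v, 0 < v → ENNReal.ofReal (r / v ^ 2) =
      ENNReal.ofReal r * ENNReal.ofReal (v ^ (-2 : ℝ)) := by
    intro v hv
    rw [← ENNReal.ofReal_mul hr.le, Real.rpow_neg hv.le, Real.rpow_two, div_eq_mul_inv]
  calc ∫⁻ z, ENNReal.ofReal (r / (r + |x - z|) ^ 2)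
      ≤ ∫⁻ z, ENNReal.ofReal r * (φ (r + x - z) + φ (z - (x - r))) := by
        refine lintegral_mono fun z => ?_
        rw [hval _ (by positivity)]
        gcongr
        rcases abs_cases (x - z) with h | h
        · refine le_add_right (le_of_eq ?_)
          have h1 : r + x - z = r + |x - z| := by rw [h.1]; ring
          rw [h1, hφ, Set.indicator_of_mem (Set.mem_Ici.2 (by linarith [abs_nonneg (x - z)]))]
        · refine le_add_left (le_of_eq ?_)
          have h1 : z - (x - r) = r + |x - z| := by rw [h.1]; ring
          rw [h1, hφ, Set.indicator_of_mem (Set.mem_Ici.2 (by linarith [abs_nonneg (x - z)]))]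
    _ = 2 := by
        rw [lintegral_const_mul' _ _ ENNReal.ofReal_ne_top,
          lintegral_add_left (show Measurable fun z => φ (r + x - z) by fun_prop),
          lintegral_sub_left_eq_self, lintegral_sub_right_eq_self φ, hφi, ← two_mul, mul_left_comm,
          ← ENNReal.ofReal_mul hr.le, mul_inv_cancel₀ hr.ne']
        simp

theorem ofReal_inv_mul_bumpIntegral {G : ℝ → ℝ≥0∞} {r : ℝ} (hr : 0 < r) (x : ℝ) :
    ENNReal.ofReal r⁻¹ * bumpIntegral G r x =
      ∫⁻ z, ENNReal.ofReal (r / (r + |x - z|) ^ 2) * G z := by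
  rw [bumpIntegral, ← lintegral_const_mul' _ _ ENNReal.ofReal_ne_top]
  refine lintegral_congr fun z => ?_
  rw [mul_left_comm, ← ENNReal.ofReal_mul (by positivity), mul_comm]
  congr 2
  field_simp

/-! ### Sections of the superlevel set -/

/-- The measure, with respect to `|x - y| ^ (γ - 1) dy`, of the section over `x` of the superlevel
set of the difference quotients. -/
noncomputable def sectionMeasure (f : ℝ → ℂ) (lam b γ x : ℝ) : ℝ≥0∞ :=
  ∫⁻ y, (diffQuotSet f lam b).indicator (fun z => ENNReal.ofReal (|z.1 - z.2| ^ (γ - 1))) (x, y)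

theorem measurable_sectionMeasure {f : ℝ → ℂ} (hf : Continuous f) (lam b γ : ℝ) :
    Measurable (sectionMeasure f lam b γ) := by
  refine Measurable.lintegral_prod_right' (f := (diffQuotSet f lam b).indicator
    fun z => ENNReal.ofReal (|z.1 - z.2| ^ (γ - 1))) (Measurable.indicator (by fun_prop) ?_)
  have hfm := hf.measurable
  have hquot : Measurable fun z : ℝ × ℝ => ‖f z.1 - f z.2‖ / |z.1 - z.2| ^ (1 + b) := by fun_prop
  exact (measurableSet_eq_fun measurable_fst measurable_snd).compl.inter
    (measurableSet_lt measurable_const hquot)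

/-- The degenerate case, in which no level radius exists: `f` is then constant. -/
theorem sectionMeasure_eq_zero {f : ℝ → ℂ} (hf : ContDiff ℝ 1 f) {q lam b γ : ℝ} (hq : 1 ≤ q)
    (hlam : 0 < lam) (h0 : ∫⁻ z, ‖deriv f z‖ₑ ^ q = 0) (x : ℝ) :
    sectionMeasure f lam b γ x = 0 := by
  have hconst : ∀ y, f x - f y = 0 := by
    intro y
    have h1 := enorm_sub_rpow_le hf hq x y
    have h2 : ∫⁻ z in Set.uIoc y x, ‖deriv f z‖ₑ ^ q = 0 :=
      le_antisymm ((setLIntegral_le_lintegral _ _).trans h0.le) zero_le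
    rw [h2, mul_zero, nonpos_iff_eq_zero, ENNReal.rpow_eq_zero_iff_of_pos (by linarith)] at h1
    simpa using h1
  refine (lintegral_congr fun y => Set.indicator_of_notMem (fun h => ?_) _).trans lintegral_zero
  have h2 := h.2
  dsimp only at h2
  rw [hconst y, norm_zero, zero_div] at h2
  exact h2.not_gt hlam

theorem IsLevelRadius.lt_abs_sub {f : ℝ → ℂ} (hf : ContDiff ℝ 1 f) {q lam γ : ℝ} (hq : 1 ≤ q)
    (hγ : γ < -1) (hlam : 0 < lam) (h0 : ∫⁻ z, ‖deriv f z‖ₑ ^ q ≠ 0)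
    (htop : ∫⁻ z, ‖deriv f z‖ₑ ^ q ≠ ∞) {R : ℝ → ℝ}
    (hR : IsLevelRadius (fun z => ‖deriv f z‖ₑ ^ q) (-γ - 1) (lam ^ q / 4) R) {x y : ℝ}
    (hxy : (x, y) ∈ diffQuotSet f lam (γ / q)) : R x < |x - y| := by
  have hq0 : 0 < q := by linarith
  obtain ⟨hne, hlt⟩ := hxy
  dsimp only at hne hlt
  set d : ℝ := |x - y| with hd
  have hd0 : 0 < d := abs_pos.2 (sub_ne_zero.2 hne)
  have hG : Measurable fun z => ‖deriv f z‖ₑ ^ q :=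
    (hf.continuous_deriv le_rfl).enorm.measurable.pow_const q
  rw [hR.lt_iff hG h0 htop (by linarith) hd0]
  set P : ℝ≥0∞ := bumpIntegral (fun z => ‖deriv f z‖ₑ ^ q) d x with hP
  have hPfin : P ≠ ∞ := ne_top_of_le_ne_top htop (bumpIntegral_le hd0 x)
  have h1 : ‖f x - f y‖ₑ ^ q ≤ ENNReal.ofReal (d ^ (q - 1)) * (4 * P) := by
    refine (enorm_sub_rpow_le hf hq x y).trans (mul_le_mul_right ?_ _)
    refine setLIntegral_le_bumpIntegral hd0 measurableSet_uIoc fun z hz => ?_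
    rw [hd, abs_sub_comm x z, abs_sub_comm x y]
    have hz' := Set.uIoc_subset_uIcc hz
    rw [Set.uIcc_comm] at hz'
    exact Set.abs_sub_left_of_mem_uIcc hz'
  have h2 : ‖f x - f y‖ ^ q ≤ d ^ (q - 1) * (4 * P.toReal) := by
    have := ENNReal.toReal_mono (ENNReal.mul_ne_top ENNReal.ofReal_ne_top
      (ENNReal.mul_ne_top (by simp) hPfin)) h1
    rwa [← ENNReal.toReal_rpow, toReal_enorm, ENNReal.toReal_mul, ENNReal.toReal_mul,
      ENNReal.toReal_ofReal (by positivity), ENNReal.toReal_ofNat] at this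
  rw [lt_div_iff₀ (by positivity)] at hlt
  have h3 := Real.rpow_lt_rpow (by positivity) hlt hq0
  rw [Real.mul_rpow hlam.le (by positivity), ← Real.rpow_mul hd0.le] at h3
  -- The exponents satisfy `(q + γ) + (-γ - 1) = q - 1`, so cancelling `d^(q+γ)` leaves exactly the
  -- power in the level equation.
  have h4 : d ^ ((1 + γ / q) * q) * d ^ (-γ - 1) = d ^ (q - 1) := by
    rw [← Real.rpow_add hd0]
    congr 1
    field_simp
    ring
  have h5 := h3.trans_le h2
  rw [← h4] at h5
  have h6 : 0 < d ^ ((1 + γ / q) * q) := by positivity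
  have h7 : lam ^ q < 4 * (d ^ (-γ - 1) * P.toReal) := by
    refine lt_of_mul_lt_mul_right (h5.trans_le (le_of_eq ?_)) h6.le
    ring
  linarith

/-- The section lies outside the interval of radius `R x`, so its measure is at most `2 / -γ * (R
x)^γ`. The level equation trades `(R x)^(γ+1)` for `4 * lam^(-q) * P(R x, x)`, which produces the
constant `8 / -γ`. -/
theorem sectionMeasure_le {f : ℝ → ℂ} (hf : ContDiff ℝ 1 f) {q lam γ : ℝ} (hq : 1 ≤ q)
    (hγ : γ < -1) (hlam : 0 < lam) (h0 : ∫⁻ z, ‖deriv f z‖ₑ ^ q ≠ 0)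
    (htop : ∫⁻ z, ‖deriv f z‖ₑ ^ q ≠ ∞) {R : ℝ → ℝ}
    (hR : IsLevelRadius (fun z => ‖deriv f z‖ₑ ^ q) (-γ - 1) (lam ^ q / 4) R) (x : ℝ) :
    sectionMeasure f lam (γ / q) γ x ≤ ENNReal.ofReal (8 / -γ * lam ^ (-q)) *
      ∫⁻ z, ENNReal.ofReal (R x / (R x + |x - z|) ^ 2) * ‖deriv f z‖ₑ ^ q := by
  have hRx := hR.pos x
  have hγ0 : 0 < -γ := by linarith
  calc sectionMeasure f lam (γ / q) γ x
      ≤ ∫⁻ y, {y | R x < |x - y|}.indicator (fun y => ENNReal.ofReal (|x - y| ^ (γ - 1))) y := by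
        refine lintegral_mono fun y => ?_
        by_cases h : (x, y) ∈ diffQuotSet f lam (γ / q)
        · have h1 : y ∈ {y | R x < |x - y|} := hR.lt_abs_sub hf hq hγ hlam h0 htop h
          simp only [Set.indicator_of_mem h, Set.indicator_of_mem h1, le_refl]
        · simp only [Set.indicator_of_notMem h]
          exact zero_le
    _ ≤ ENNReal.ofReal (2 * (-R x ^ (γ - 1 + 1) / (γ - 1 + 1))) :=
        lintegral_indicator_lt_abs_sub_rpow_le (by linarith) hRx x
    _ = ENNReal.ofReal (8 / -γ * lam ^ (-q)) * (ENNReal.ofReal (R x)⁻¹ *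
          bumpIntegral (fun z => ‖deriv f z‖ₑ ^ q) (R x) x) := by
        rw [← ENNReal.ofReal_toReal (ne_top_of_le_ne_top htop (bumpIntegral_le hRx x)),
          ← ENNReal.ofReal_mul (by positivity), ← ENNReal.ofReal_mul (by positivity)]
        congr 1
        have h1 := hR.eq x
        have h2 : 0 < R x ^ (-γ - 1) := by positivity
        have h3 : R x ^ γ = (R x)⁻¹ * (R x ^ (-γ - 1))⁻¹ := by
          rw [← Real.rpow_neg_one, ← Real.rpow_neg hRx.le, ← Real.rpow_add hRx]
          congr 1
          ring
        have h4 : 0 < lam ^ q := by positivity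
        rw [sub_add_cancel, h3, Real.rpow_neg hlam.le,
          show lam ^ q = 4 * (R x ^ (-γ - 1) *
            (bumpIntegral (fun z => ‖deriv f z‖ₑ ^ q) (R x) x).toReal) by linarith]
        have h5 : 0 < (bumpIntegral (fun z => ‖deriv f z‖ₑ ^ q) (R x) x).toReal := by
          by_contra! h
          nlinarith
        have hγ1 : γ ≠ 0 := by linarith
        field_simp
        norm_num
    _ = _ := by rw [ofReal_inv_mul_bumpIntegral hRx]

theorem lintegral_enorm_deriv_rpow_ne_top {f : ℝ → ℂ} (hf : ContDiff ℝ 1 f)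
    (hfc : HasCompactSupport (deriv f)) {q : ℝ} (hq : 0 < q) :
    ∫⁻ z, ‖deriv f z‖ₑ ^ q ≠ ∞ := by
  have h := (hf.continuous_deriv le_rfl).memLp_of_hasCompactSupport (μ := volume)
    (p := ENNReal.ofReal q) hfc
  have h1 := lintegral_rpow_enorm_lt_top_of_eLpNorm_lt_top (by simpa using hq) (by simp) h.2
  rw [ENNReal.toReal_ofReal hq.le] at h1
  exact h1.ne

/-! ### The weighted estimate -/

/-- The weighted estimate, with the maximal function of the weight on the right. -/
theorem exists_lintegral_sectionMeasure_rpow_mul_le {p q γ : ℝ} (hq : 1 ≤ q) (hqp : q ≤ p)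
    (hγ : γ < -1) : ∃ K : ℝ≥0, ∀ f : ℝ → ℂ, ContDiff ℝ 1 f → HasCompactSupport (deriv f) →
      ∀ lam : ℝ, 0 < lam → ∀ g : ℝ → ℝ≥0∞, Measurable g →
        ∫⁻ x, sectionMeasure f lam (γ / q) γ x ^ (p / q) * g x ≤
          K * ENNReal.ofReal (lam ^ (-p)) * ∫⁻ z, ‖deriv f z‖ₑ ^ p * hlMaximal g z := by
  have hq0 : 0 < q := by linarith
  have hs : 1 ≤ p / q := (one_le_div hq0).2 hqp
  have hs0 : 0 < p / q := by linarith
  have hγ0 : 0 < -γ := by linarith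
  set a : ℝ := -γ - 1 with ha
  have ha0 : 0 < a := by linarith
  -- This is integrability of the degraded kernel; it holds because `γ < -1` makes `a` positive.
  have hθ : 1 < 2 - 2 / (a + 2) := by
    have : 2 / (a + 2) < 1 := (div_lt_one (by linarith)).2 (by linarith)
    linarith
  obtain ⟨C, hC⟩ := exists_lintegral_radial_le_hlMaximal hθ
  set B : ℝ := 4 * 4 ^ (1 / a) with hB
  have hB0 : 0 ≤ B := by positivity
  set D : ℝ := (8 / -γ) ^ (p / q) * 2 ^ (p / q - 1) with hD
  have hD0 : 0 ≤ D := by positivity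
  refine ⟨D.toNNReal * B.toNNReal * C, fun f hf hfc lam hlam g hg => ?_⟩
  have hF : Measurable fun z => ‖deriv f z‖ₑ := (hf.continuous_deriv le_rfl).enorm.measurable
  have htop := lintegral_enorm_deriv_rpow_ne_top hf hfc hq0
  by_cases h0 : ∫⁻ z, ‖deriv f z‖ₑ ^ q = 0
  · simp_rw [sectionMeasure_eq_zero hf hq hlam h0, ENNReal.zero_rpow_of_pos hs0, zero_mul,
      lintegral_zero]
    exact zero_le
  have hG : Measurable fun z => ‖deriv f z‖ₑ ^ q := hF.pow_const q
  obtain ⟨R, hR⟩ := exists_isLevelRadius (L := lam ^ q / 4) hG h0 htop ha0 (by positivity)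
  have hRm := hR.measurable hG h0 htop ha0
  set k : ℝ → ℝ → ℝ≥0∞ := fun x z => ENNReal.ofReal (R x / (R x + |x - z|) ^ 2) with hk
  have hkm : Measurable fun w : ℝ × ℝ => k w.1 w.2 := by
    have h1 : Measurable fun w : ℝ × ℝ => R w.1 := hRm.comp measurable_fst
    simp only [hk]
    fun_prop
  have hpt : ∀ x, sectionMeasure f lam (γ / q) γ x ^ (p / q) ≤
      ENNReal.ofReal (D * lam ^ (-p)) * ∫⁻ z, k x z * ‖deriv f z‖ₑ ^ p := by
    intro x
    have hkx : Measurable (k x) := hkm.comp measurable_prodMk_left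
    -- Jensen's inequality for the measure with density `k x`, whose total mass is at most `2`
    -- whatever the value of `R x`.
    have h1 := lintegral_rpow_le_measure_univ_mul (volume.withDensity (k x)) hG.aemeasurable hs
    rw [lintegral_withDensity_eq_lintegral_mul _ hkx hG,
      lintegral_withDensity_eq_lintegral_mul _ hkx (hG.pow_const _), withDensity_apply _ .univ,
      Measure.restrict_univ] at h1
    simp only [Pi.mul_apply, ← ENNReal.rpow_mul, mul_div_cancel₀ p hq0.ne'] at h1
    calc sectionMeasure f lam (γ / q) γ x ^ (p / q)
        ≤ (ENNReal.ofReal (8 / -γ * lam ^ (-q)) * ∫⁻ z, k x z * ‖deriv f z‖ₑ ^ q) ^ (p / q) :=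
          ENNReal.rpow_le_rpow (sectionMeasure_le hf hq hγ hlam h0 htop hR x) hs0.le
      _ ≤ ENNReal.ofReal (8 / -γ * lam ^ (-q)) ^ (p / q) *
            (2 ^ (p / q - 1) * ∫⁻ z, k x z * ‖deriv f z‖ₑ ^ p) := by
          rw [ENNReal.mul_rpow_of_nonneg _ _ hs0.le]
          refine mul_le_mul_right (h1.trans ?_) _
          gcongr
          exact lintegral_bump_le (hR.pos x) x
      _ = _ := by
          rw [← mul_assoc]
          congr 1
          have h2 : (2 : ℝ≥0∞) ^ (p / q - 1) = ENNReal.ofReal (2 ^ (p / q - 1)) := by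
            rw [← ENNReal.ofReal_rpow_of_pos (by norm_num), ENNReal.ofReal_ofNat]
          rw [ENNReal.ofReal_rpow_of_pos (by positivity), h2, ← ENNReal.ofReal_mul (by positivity),
            Real.mul_rpow (by positivity) (by positivity), ← Real.rpow_mul hlam.le, hD]
          congr 1
          rw [neg_mul, mul_div_cancel₀ p hq0.ne']
          ring
  -- Here `x` is integrated, so the width `R x` is not fixed; comparison with the width `R z` yields
  -- a genuine radial kernel about `z`.
  have hker : ∀ z, ∫⁻ x, k x z * g x ≤ (B.toNNReal * C : ℝ≥0) * hlMaximal g z := by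
    intro z
    calc ∫⁻ x, k x z * g x ≤ ∫⁻ x, ENNReal.ofReal B *
          (ENNReal.ofReal ((R z)⁻¹ * (1 + |x - z| / R z) ^ (-(2 - 2 / (a + 2)))) * g x) := by
          refine lintegral_mono fun x => ?_
          dsimp only
          rw [← mul_assoc, ← ENNReal.ofReal_mul hB0]
          refine mul_le_mul_left (ENNReal.ofReal_le_ofReal ?_) _
          refine bump_le_of_comparable ha0 (hR.pos x) (hR.pos z) (abs_nonneg _)
            (hR.div_rpow_le hG h0 htop ha0 x z) ?_
          rw [abs_sub_comm]
          exact hR.div_rpow_le hG h0 htop ha0 z x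
      _ ≤ ENNReal.ofReal B * (C * hlMaximal g z) := by
          rw [lintegral_const_mul' _ _ ENNReal.ofReal_ne_top]
          exact mul_le_mul_right (hC g hg z _ (hR.pos z)) _
      _ = _ := by rw [ENNReal.coe_mul, ← mul_assoc]; rfl
  calc ∫⁻ x, sectionMeasure f lam (γ / q) γ x ^ (p / q) * g x
      ≤ ∫⁻ x, ENNReal.ofReal (D * lam ^ (-p)) * ∫⁻ z, k x z * ‖deriv f z‖ₑ ^ p * g x := by
        refine lintegral_mono fun x => ?_
        have hkx : Measurable (k x) := hkm.comp measurable_prodMk_left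
        have h1 : Measurable fun z => k x z * ‖deriv f z‖ₑ ^ p := hkx.mul (hF.pow_const p)
        rw [lintegral_mul_const _ h1, ← mul_assoc]
        exact mul_le_mul_left (hpt x) _
    _ = ENNReal.ofReal (D * lam ^ (-p)) * ∫⁻ z, ‖deriv f z‖ₑ ^ p * ∫⁻ x, k x z * g x := by
        rw [lintegral_const_mul' _ _ ENNReal.ofReal_ne_top, lintegral_lintegral_swap]
        · congr 1
          refine lintegral_congr fun z => ?_
          have h1 : Measurable fun x => k x z * g x := (hkm.comp measurable_prodMk_right).mul hg
          rw [← lintegral_const_mul _ h1]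
          refine lintegral_congr fun x => ?_
          ring
        · exact ((hkm.mul ((hF.pow_const p).comp measurable_snd)).mul
            (hg.comp measurable_fst)).aemeasurable
    _ ≤ ENNReal.ofReal (D * lam ^ (-p)) *
          ∫⁻ z, (B.toNNReal * C : ℝ≥0) * (‖deriv f z‖ₑ ^ p * hlMaximal g z) := by
        refine mul_le_mul_right (lintegral_mono fun z => ?_) _
        rw [mul_left_comm]
        exact mul_le_mul_right (hker z) _
    _ = _ := by
        rw [lintegral_const_mul' _ _ ENNReal.coe_ne_top, ENNReal.ofReal_mul hD0, mul_assoc D.toNNReal,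
          ENNReal.coe_mul D.toNNReal]
        simp only [ENNReal.ofReal]
        ring

/-! ### Passage to the norm of the space -/

theorem mainTheorem6 (p q γ : ℝ) (hp : 1 ≤ p) (hq : 1 ≤ q) (hqp : q ≤ p) (hγ : γ < -1) :
    ∃ C : ℝ≥0 → ℝ≥0, Continuous C ∧ StrictMono C ∧ (∀ t, 0 < C t) ∧
      ∀ ρ : (ℝ → ℝ≥0∞) → ℝ≥0∞,
        IsBallBanachFunctionNorm ρ →
        IsBallBanachFunctionNorm (convexification (1 / p) ρ) →
        HLMaximalBounded (associateNorm (convexification (1 / p) ρ)) →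
        ∀ f : ℝ → ℂ, ContDiff ℝ 1 f → HasCompactSupport (deriv f) →
          ⨆ (lam : ℝ) (_ : 0 < lam),
              ENNReal.ofReal lam *
                ρ (fun x => (∫⁻ y, (diffQuotSet f lam (γ / q)).indicator
                    (fun z => ENNReal.ofReal (|z.1 - z.2| ^ (γ - 1))) (x, y)) ^ (1 / q))
            ≤ C (hlMaximalOpNorm (associateNorm (convexification (1 / p) ρ))) *
                ρ (fun x => ‖deriv f x‖ₑ) := by
  have hp0 : 0 < p := by linarith
  have hq0 : 0 < q := by linarith
  obtain ⟨K, hK⟩ := exists_lintegral_sectionMeasure_rpow_mul_le hq hqp hγ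
  -- The estimate itself needs only `(K * t)^(1/p)`; the summand `t + 1` ensures strict monotonicity
  -- and positivity, even if `K = 0`.
  refine ⟨fun t => (K * t) ^ (1 / p) + (t + 1), ?_, ?_, fun t => by positivity, ?_⟩
  · exact ((NNReal.continuous_rpow_const (by positivity)).comp (continuous_const_mul K)).add
      (continuous_id.add continuous_const)
  · intro s t hst
    refine add_lt_add_of_le_of_lt (NNReal.rpow_le_rpow ?_ (by positivity)) (by gcongr)
    gcongr
  intro ρ hρ hσ hM f hf hfc
  set σ := convexification (1 / p) ρ with hσdef
  set A := hlMaximalOpNorm (associateNorm σ) with hA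
  set N := ρ (fun x => ‖deriv f x‖ₑ) with hN
  have hF : Measurable fun z => ‖deriv f z‖ₑ := (hf.continuous_deriv le_rfl).enorm.measurable
  have hσF : σ (fun x => ‖deriv f x‖ₑ ^ p) = N ^ p := by
    rw [hσdef, convexification, one_div_one_div]
    simp_rw [← ENNReal.rpow_mul, mul_one_div_cancel hp0.ne', ENNReal.rpow_one]
    rfl
  -- Hölder's inequality below needs a finite norm; otherwise the right side is infinite because the
  -- constant is positive.
  by_cases hNtop : N = ∞
  · rw [hNtop, ENNReal.mul_top]
    · exact le_top
    · exact ENNReal.coe_ne_zero.2 (by positivity)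
  refine iSup_le fun lam => iSup_le fun hlam => ?_
  have hWm : Measurable fun x => sectionMeasure f lam (γ / q) γ x ^ (p / q) :=
    (measurable_sectionMeasure hf.continuous lam (γ / q) γ).pow_const _
  have hdual : σ (fun x => sectionMeasure f lam (γ / q) γ x ^ (p / q)) ≤
      K * ENNReal.ofReal (lam ^ (-p)) * (N ^ p * A) := by
    refine norm_le_of_forall_associateNorm_le_one hσ hWm.aemeasurable fun g hg hg1 => ?_
    refine (hK f hf hfc lam hlam g hg).trans (mul_le_mul_right ?_ _)
    refine (lintegral_mul_le_associateNorm_mul hσ.toIsBallQuasiBanachFunctionNorm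
      (hF.pow_const p).aemeasurable ?_ (hlMaximal g)).trans ?_
    · rw [hσF]
      exact ENNReal.rpow_ne_top_of_nonneg hp0.le hNtop
    · rw [hσF]
      refine mul_le_mul_right ?_ _
      refine (hlMaximalBoundedBy_hlMaximalOpNorm hM g hg.aemeasurable
        (hg1.trans_lt ENNReal.one_lt_top)).trans ?_
      exact mul_le_of_le_one_right zero_le hg1
  have hroot : ∀ w : ℝ≥0∞, (w ^ (p / q)) ^ (1 / p) = w ^ (1 / q) := by
    intro w
    rw [← ENNReal.rpow_mul]
    congr 1
    field_simp
  -- Unfolding the convexification turns the power `p / q` into `1 / q`; a `p`th root then gives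
  -- `lam⁻¹`, cancelling the factor `lam`.
  rw [hσdef, convexification, one_div_one_div] at hdual
  simp_rw [hroot] at hdual
  have h1 := ENNReal.rpow_le_rpow hdual (z := 1 / p) (by positivity)
  rw [← ENNReal.rpow_mul, mul_one_div_cancel hp0.ne', ENNReal.rpow_one] at h1
  calc ENNReal.ofReal lam * ρ (fun x => sectionMeasure f lam (γ / q) γ x ^ (1 / q))
      ≤ ENNReal.ofReal lam * (K * ENNReal.ofReal (lam ^ (-p)) * (N ^ p * A)) ^ (1 / p) := by
        gcongr
    _ = (ENNReal.ofReal lam * ENNReal.ofReal lam⁻¹) * ((K * A : ℝ≥0∞) ^ (1 / p) * N) := by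
        have h2 : (ENNReal.ofReal (lam ^ (-p))) ^ (1 / p) = ENNReal.ofReal lam⁻¹ := by
          rw [ENNReal.ofReal_rpow_of_pos (by positivity), ← Real.rpow_mul hlam.le, neg_mul,
            mul_one_div_cancel hp0.ne', Real.rpow_neg_one]
        have h3 : (N ^ p) ^ (1 / p) = N := by
          rw [← ENNReal.rpow_mul, mul_one_div_cancel hp0.ne', ENNReal.rpow_one]
        have hp1 : 0 ≤ 1 / p := by positivity
        simp only [ENNReal.mul_rpow_of_nonneg _ _ hp1, h2, h3]
        ring
    _ = (K * A : ℝ≥0∞) ^ (1 / p) * N := by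
        rw [← ENNReal.ofReal_mul hlam.le, mul_inv_cancel₀ hlam.ne', ENNReal.ofReal_one, one_mul]
    _ ≤ _ := by
        gcongr
        rw [ENNReal.coe_add, ENNReal.coe_rpow_of_nonneg _ (by positivity), ENNReal.coe_mul]
        exact le_self_add
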